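/- Let $\overline{\mathbb Q}\subset\mathbb C$ be the field of algebraic numbers. For $a,b,d\in\overline{\mathbb Q}$ put $V=\begin{pmatrix}a&b\\-b&d\end{pmatrix}$, $L_S=\operatorname{diag}(1,-1)$, and consider the pencil $A(u;\lambda)=u^2I-L_S-\lambda u^{-1}V$ (with $u=z^{1/2}$, $u\neq0$). Put $\tau=a+d$, $\delta=a-d$, $\Delta=ad+b^2$, $\mu=-b^2$. The pencil is smooth if $\Delta\,\mu\,(\tau^2-4\Delta)(\delta^2+4\Delta)\ne0$, and the $j$-moduli map sends a smooth pencil to $$j(\tau,\delta,\Delta,\mu)=\frac{16(\tau^2\delta^2+12\Delta\mu)^3}{\Delta^2\mu^2(\tau^2-4\Delta)(\delta^2+4\Delta)}.$$ The spectral curve is the plane curve $P(u,\lambda)=u^2\det A(u;\lambda)=0$. For numbers $t$ and $q\ne0$ the master quadratic is $\mathcal A Y^2+\mathcal B Y+\mathcal C=0$ with $\mathcal A=\tau^2-4\Delta$, $\mathcal B=-\frac{t\mathcal A}{q}+2\delta\tau$, $\mathcal C=\tau^2-\frac{t\delta\tau}{q}-\frac{\Delta t^2}{q^2}+\frac{\tau^2}{q}$.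 The pencil is $J$-self-adjoint, for $J=\operatorname{diag}(1,-1)$, if $JA(u;\lambda)^\dagger J=A(u;\lambda)$ for all real $\lambda$ and $u\ne0$, that is, if $a,b,d$ are real. Theorem. (1) The image of the $j$-moduli map on the smooth pencils over $\overline{\mathbb Q}$ is Zariski-dense in $\mathbb P^1_{\overline{\mathbb Q}}$. (2) Let $E$ be an elliptic curve over $\overline{\mathbb Q}$ whose $j$-invariant lies in this image. Then there is a smooth pencil over $\overline{\mathbb Q}$, with $j(\tau,\delta,\Delta,\mu)=j(E)$, such that: (a) $P$ is irreducible and the smooth projective model of the spectral curve $P=0$ is isomorphic to $E$ over $\overline{\mathbb Q}$ (equivalently, their function fields are isomorphic over $\overline{\mathbb Q}$); (b) for every number field $K\hookrightarrow\overline{\mathbb Q}$, every model $E_0/K$ of $E$ and every prime $v$ of $K$ at which $E_0$ has good reduction, with $q=\#k_v$ and $t=a_v=q+1-\#\tilde E_0(k_v)$: one has $\tau\ne0$ and $\mathcal A\neq 0$, the master quadratic has a nonzero root in $\mathbb C$, and for every $u\in\mathbb C^\times$ such that $u^2$ is a root, with $\lambda=\frac{2u^3}{\tau}-\frac{a_vu}{q\tau}$,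 the matrix $A(u;\lambda)$ is invertible and its inverse $R$ satisfies, for all $s\in\mathbb C$, $$\det(I-q^{-s}R)=1-a_vq^{-s}+q^{1-2s},$$ the Hasse–Weil Euler factor of $E_0$ at $v$. (For $K=\mathbb Q$ this is the factor $1-a_pp^{-s}+p^{1-2s}$ at every good prime $p$.) (3) Statements (1) and (2) also hold with "pencil over $\overline{\mathbb Q}$" replaced throughout by "$J$-self-adjoint pencil over $\overline{\mathbb Q}$", both in the domain of the $j$-moduli map and in the conclusion. -/

import Mathlib

open scoped Matrix Polynomial LinearAlgebra.Projectivization NumberField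
open IsDedekindDomain

noncomputable section

/-- The field of algebraic numbers, as a subfield of `ℂ`. -/
abbrev QBar : Type := algebraicClosure ℚ ℂ

/-- The `2 × 2` pencil `u² - L_S - λ u⁻¹ V` with `L_S = diag(1, -1)` and coupling matrix
`V = (a, b; -b, d)`, recorded through the entries of `V`. The variable `u` is `z^{1/2}`, so that
`u⁻¹` is the causal kernel `z^{-1/2}`. -/
structure CausalPencil (F : Type*) where
  a : F
  b : F
  d : F

namespace CausalPencil

variable {F : Type*} [Field F]

/-- The system operator `diag(1, -1)`, over any commutative ring. -/
def systemOp (R : Type*) [CommRing R] : Matrix (Fin 2) (Fin 2) R := !![1, 0; 0, -1]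

/-- The fundamental symmetry `J = diag(1, -1)`. -/
def fundSymm (R : Type*) [CommRing R] : Matrix (Fin 2) (Fin 2) R := !![1, 0; 0, -1]

/-- The coupling matrix `V`. -/
def coupling (V : CausalPencil F) : Matrix (Fin 2) (Fin 2) F := !![V.a, V.b; -V.b, V.d]

/-- The pencil `A(u; λ) = u² - L_S - λ u⁻¹ V` (meaningful for `u ≠ 0`). -/
def pencil (V : CausalPencil F) (u l : F) : Matrix (Fin 2) (Fin 2) F :=
  u ^ 2 • (1 : Matrix (Fin 2) (Fin 2) F) - systemOp F - (l * u⁻¹) • V.coupling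

/-- `τ = tr V`. -/
def tau (V : CausalPencil F) : F := V.a + V.d

/-- `δ = a - d`. -/
def delta (V : CausalPencil F) : F := V.a - V.d

/-- `Δ = det V`. -/
def Delta (V : CausalPencil F) : F := V.a * V.d + V.b ^ 2

/-- `μ = v₁₂ v₂₁`. -/
def mu (V : CausalPencil F) : F := -V.b ^ 2

/-- The smooth parameter locus: the denominator of the `j`-moduli map does not vanish. -/
def IsSmooth (V : CausalPencil F) : Prop :=
  V.Delta ^ 2 * V.mu ^ 2 * (V.tau ^ 2 - 4 * V.Delta) * (V.delta ^ 2 + 4 * V.Delta) ≠ 0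

/-- The `j`-moduli map `(τ, δ, Δ, μ) ↦ j` (meaningful on the smooth locus). -/
def jMap (V : CausalPencil F) : F :=
  16 * (V.tau ^ 2 * V.delta ^ 2 + 12 * V.Delta * V.mu) ^ 3 /
    (V.Delta ^ 2 * V.mu ^ 2 * (V.tau ^ 2 - 4 * V.Delta) * (V.delta ^ 2 + 4 * V.Delta))

/-- The spectral polynomial `P(u, λ) = u² det A(u; λ) = det (u A(u; λ))`, an element of
`F[u][λ]`. -/
def spectralPoly (V : CausalPencil F) : F[X][X] :=
  let u : F[X][X] := Polynomial.C Polynomial.X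
  let l : F[X][X] := Polynomial.X
  (u ^ 3 • (1 : Matrix (Fin 2) (Fin 2) F[X][X]) - u • systemOp F[X][X]
    - l • V.coupling.map (fun x => Polynomial.C (Polynomial.C x))).det

/-- The spectral curve `P(u, λ) = 0` is an integral curve whose smooth projective model is
isomorphic over `F` to the elliptic curve `E`. The plane curve `P = 0` itself is singular and not
complete; two smooth projective curves over `F` are isomorphic over `F` exactly if their function
fields are isomorphic over `F`, and this is how the isomorphism is expressed. -/
def SpectralCurveIso (V : CausalPencil F) (E : WeierstrassCurve F) : Prop :=
  Irreducible V.spectralPoly ∧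
    Nonempty (FractionRing (AdjoinRoot V.spectralPoly) ≃ₐ[F] E.toAffine.FunctionField)

/-- The leading coefficient of the master quadratic. -/
def masterA (V : CausalPencil F) : F := V.tau ^ 2 - 4 * V.Delta

/-- The middle coefficient of the master quadratic for the trace `t` and the norm `q`. -/
def masterB (V : CausalPencil F) (t q : F) : F :=
  -(t * V.masterA / q) + 2 * V.delta * V.tau

/-- The constant coefficient of the master quadratic for the trace `t` and the norm `q`. -/
def masterC (V : CausalPencil F) (t q : F) : F :=
  V.tau ^ 2 - t * V.delta * V.tau / q - V.Delta * t ^ 2 / q ^ 2 + V.tau ^ 2 / q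

/-- `Y` is a root of the master quadratic. -/
def IsMasterRoot (V : CausalPencil F) (t q Y : F) : Prop :=
  V.masterA * Y ^ 2 + V.masterB t q * Y + V.masterC t q = 0

/-- The second coordinate `λ = 2u³/τ - t u/(q τ)` of the basepoint with first coordinate `u`. -/
def basepointLambda (V : CausalPencil F) (t q u : F) : F :=
  2 * u ^ 3 / V.tau - t * u / (q * V.tau)

/-- The pencil over `ℂ` given by a pencil with algebraic entries. -/
def toComplex (V : CausalPencil QBar) : CausalPencil ℂ := ⟨V.a, V.b, V.d⟩

/-- `J`-self-adjointness `J A† J = A` of the pencil at all real `(u, λ)`, `u ≠ 0`; for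
`V = (a, b; -b, d)` this says that `a, b, d` are real. -/
def IsJSelfAdjoint (V : CausalPencil QBar) : Prop :=
  ∀ u l : ℝ, u ≠ 0 →
    fundSymm ℂ * (V.toComplex.pencil (u : ℂ) (l : ℂ))ᴴ * fundSymm ℂ =
      V.toComplex.pencil (u : ℂ) (l : ℂ)

end CausalPencil

/-- The Zariski topology on the closed points of the projective line over `F`: the open sets are
the unions of the complements of zero loci of homogeneous polynomials. -/
@[reducible] def zariskiTopology (F : Type*) [Field F] : TopologicalSpace (ℙ F (Fin 2 → F)) :=
  TopologicalSpace.generateFrom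
    {U | ∃ (n : ℕ) (f : MvPolynomial (Fin 2) F), f.IsHomogeneous n ∧
      U = {x | MvPolynomial.eval x.rep f ≠ 0}}

/-- Zariski density in the projective line. -/
def ZariskiDense {F : Type*} [Field F] (S : Set (ℙ F (Fin 2 → F))) : Prop :=
  @Dense _ (zariskiTopology F) S

/-- The point `[t : 1]` of the projective line. -/
def affinePoint {F : Type*} [Field F] (t : F) : ℙ F (Fin 2 → F) :=
  Projectivization.mk F ![t, 1] (fun h => one_ne_zero (congrFun h 1))

/-- The image in the projective `j`-line of the smooth pencils in `S` under the `j`-moduli map. -/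
def jImage {F : Type*} [Field F] (S : Set (CausalPencil F)) : Set (ℙ F (Fin 2 → F)) :=
  {x | ∃ V ∈ S, V.IsSmooth ∧ x = affinePoint V.jMap}

section Arithmetic

variable {K : Type} [Field K] [NumberField K]

/-- The completion of `W` at the prime `v` has good reduction. -/
def GoodPrime (W : WeierstrassCurve K) (v : HeightOneSpectrum (𝓞 K)) : Prop :=
  ((W.baseChange (v.adicCompletion K)).minimal (v.adicCompletionIntegers K)).HasGoodReduction
    (v.adicCompletionIntegers K)

/-- The cardinality `q` of the residue field at `v`. -/
def primeNorm (v : HeightOneSpectrum (𝓞 K)) : ℕ :=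
  Nat.card (IsLocalRing.ResidueField (v.adicCompletionIntegers K))

/-- The trace of Frobenius `q + 1 - #W̃(k_v)` at a prime of good reduction. -/
def frobTrace (W : WeierstrassCurve K) (v : HeightOneSpectrum (𝓞 K)) : ℤ :=
  (primeNorm v : ℤ) + 1 -
    Nat.card (((W.baseChange (v.adicCompletion K)).minimal
      (v.adicCompletionIntegers K)).reduction (v.adicCompletionIntegers K)).toAffine.Point

/-- The Hasse–Weil Euler factor of `W` at `v`, that is the local polynomial at `q^{-s}`. -/
def eulerFactor (W : WeierstrassCurve K) (v : HeightOneSpectrum (𝓞 K)) (s : ℂ) : ℂ :=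
  Polynomial.aeval ((primeNorm v : ℂ) ^ (-s))
    ((W.baseChange (v.adicCompletion K)).localPolynomial (v.adicCompletionIntegers K))

/-- The master quadratic of `V` produces the Euler factor of `W` at `v`: it is a genuine quadratic
with a nonzero root, and for every nonzero root `u²` the pencil at the basepoint `(u, λ)` is
invertible, with resolvent `R` satisfying `det (1 - q^{-s} R) = 1 - a q^{-s} + q^{1-2s}`, the Euler
factor. -/
def ProducesEulerFactor (V : CausalPencil QBar) (W : WeierstrassCurve K)
    (v : HeightOneSpectrum (𝓞 K)) : Prop :=
  let q : ℂ := (primeNorm v : ℂ)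
  let t : ℂ := (frobTrace W v : ℂ)
  let Vc := V.toComplex
  Vc.tau ≠ 0 ∧ Vc.masterA ≠ 0 ∧
  (∃ Y : ℂ, Y ≠ 0 ∧ Vc.IsMasterRoot t q Y) ∧
  ∀ u : ℂ, u ≠ 0 → Vc.IsMasterRoot t q (u ^ 2) →
    let A := Vc.pencil u (Vc.basepointLambda t q u)
    IsUnit A.det ∧
    ∀ s : ℂ, (1 - q ^ (-s) • A⁻¹).det = 1 - t * q ^ (-s) + q ^ (1 - 2 * s) ∧
      (1 - q ^ (-s) • A⁻¹).det = eulerFactor W v s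

end Arithmetic

/-- The pencil `V` realises the elliptic curve `E`: the value of the `j`-moduli map is `j(E)`, the
spectral curve is isomorphic to `E`, and for every model of `E` over a number field and every good
prime of that model, the master quadratic of `V` produces the Euler factor. -/
def Realises (V : CausalPencil QBar) (E : WeierstrassCurve QBar) [E.IsElliptic] : Prop :=
  V.IsSmooth ∧ V.jMap = E.j ∧ V.SpectralCurveIso E ∧
  ∀ (K : Type) [Field K] [NumberField K] (ι : K →+* QBar) (W : WeierstrassCurve K),
    (∃ C : WeierstrassCurve.VariableChange QBar, C • W.map ι = E) →
    ∀ v : HeightOneSpectrum (𝓞 K), GoodPrime W v → ProducesEulerFactor V W v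

end

/-! Completing the square in `λ` turns the spectral curve into `w² = αu⁴ + βu² + γ` with
`α = τ² - 4Δ`, `β = 2τδ` and `γ = δ² + 4Δ`. Over an algebraically closed field this curve of genus
one is isomorphic to its Jacobian `y² = (x + β)(x² - 4αγ)`, whose `j`-invariant is the value of the
`j`-moduli map.

That value is `64 (3 + c)³ / (1 - c)²` with `c = β² / 4αγ`. Prescribing it is a cubic equation for
`c`, which has a root over every algebraically closed and every real closed field; so every
algebraic number is a value of the map, and every real algebraic number is one at a pencil with
real entries. In particular every natural number is a value, and an infinite subset of the
projective line is Zariski dense.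

Once `c` is fixed, `τ²` is still a free parameter, and it can be chosen so that the master quadratic
always has a nonzero root. If `u²` is such a root, the pencil at the basepoint has determinant
`1 / q` and trace `t / q`, and this makes the resolvent produce the Euler factor.
-/

section RealClosed

open Polynomial

theorem exists_irreducible_odd_natDegree_dvd {F : Type*} [Field F] {p : F[X]}
    (hp : Odd p.natDegree) : ∃ g, Irreducible g ∧ g ∣ p ∧ Odd g.natDegree := by
  induction hn : p.natDegree using Nat.strong_induction_on generalizing p with
  | _ n ih =>
    obtain ⟨g, hg, h, rfl⟩ := exists_irreducible_of_natDegree_pos hp.pos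
    by_cases hodd : Odd g.natDegree
    · exact ⟨g, hg, dvd_mul_right g h, hodd⟩
    · have hh : h ≠ 0 := by rintro rfl; simp at hp
      rw [natDegree_mul hg.ne_zero hh] at hp hn
      have hpos := hg.natDegree_pos
      obtain ⟨g', hg', hdvd, hodd'⟩ := ih h.natDegree (by omega)
        ((Nat.odd_add'.mp hp).mpr (Nat.not_odd_iff_even.mp hodd)) rfl
      exact ⟨g', hg', hdvd.mul_left g, hodd'⟩

theorem isRealClosed_real : IsRealClosed ℝ :=
  .of_linearOrderedField (fun hx => ⟨_, (Real.mul_self_sqrt hx).symm⟩) fun {p} hp => by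
    obtain ⟨g, hg, hdvd, hodd⟩ := exists_irreducible_odd_natDegree_dvd hp
    have hdeg : g.natDegree ≤ 2 := natDegree_le_of_degree_le hg.degree_le_two
    have hdeg_one : g.natDegree = 1 := by obtain ⟨k, hk⟩ := hodd; omega
    obtain ⟨x, hx⟩ := exists_root_of_degree_eq_one
      ((degree_eq_iff_natDegree_eq_of_pos one_pos).mpr hdeg_one)
    exact ⟨x, hx.dvd hdvd⟩

theorem isRealClosed_algebraicClosure (k R : Type*) [Field k] [Field R] [LinearOrder R]
    [IsStrictOrderedRing R] [IsRealClosed R] [Algebra k R] :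
    IsRealClosed (algebraicClosure k R) := by
  refine .of_linearOrderedField (fun {x} hx => ?_) fun {p} hp => ?_
  · obtain ⟨r, hr⟩ := IsRealClosed.exists_eq_pow_of_nonneg (R := R) (x := x) hx two_ne_zero
    have hr_mem : r ∈ algebraicClosure k R :=
      mem_algebraicClosure_iff.mpr (.of_pow two_pos (hr ▸ mem_algebraicClosure_iff.mp x.2))
    exact ⟨⟨r, hr_mem⟩, Subtype.ext (hr.trans (sq r))⟩
  · obtain ⟨r, hr⟩ := IsRealClosed.exists_isRoot_of_odd_natDegree (R := R)
      (f := p.map (algebraMap (algebraicClosure k R) R)) (by simpa using hp)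
    have hr_alg : IsAlgebraic (algebraicClosure k R) r :=
      ⟨p, fun h => by simp [h] at hp, by rwa [IsRoot, eval_map_algebraMap] at hr⟩
    have hr_mem : r ∈ algebraicClosure k R :=
      mem_algebraicClosure_iff.mpr (hr_alg.restrictScalars k)
    refine ⟨⟨r, hr_mem⟩, ?_⟩
    have h : algebraMap (algebraicClosure k R) R (p.eval ⟨r, hr_mem⟩) = 0 := by
      rw [← eval_map_apply]
      exact hr
    exact (map_eq_zero _).mp h

end RealClosed

section ProjectiveLine

open Topology

variable {F : Type*} [Field F]

theorem eval_smul_of_isHomogeneous {σ R : Type*} [CommSemiring R] {f : MvPolynomial σ R} {n : ℕ}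
    (hf : f.IsHomogeneous n) (a : R) (x : σ → R) :
    MvPolynomial.eval (a • x) f = a ^ n * MvPolynomial.eval x f := by
  rw [MvPolynomial.eval_eq, MvPolynomial.eval_eq, Finset.mul_sum]
  refine Finset.sum_congr rfl fun d hd => ?_
  have hdeg : ∑ i ∈ d.support, d i = n := by
    rw [← hf (MvPolynomial.mem_support_iff.mp hd), Finsupp.weight_apply, Finsupp.sum]
    simp
  simp only [Pi.smul_apply, smul_eq_mul, mul_pow, Finset.prod_mul_distrib,
    Finset.prod_pow_eq_pow_sum, hdeg]
  ring

theorem affinePoint_injective : Function.Injective (affinePoint : F → ℙ F (Fin 2 → F)) := by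
  classical
  exact (OnePoint.equivProjectivization F).injective.comp OnePoint.coe_injective

theorem eval_rep_affinePoint_eq_zero_iff {f : MvPolynomial (Fin 2) F} {n : ℕ}
    (hf : f.IsHomogeneous n) (t : F) : MvPolynomial.eval (affinePoint t).rep f = 0 ↔
      (MvPolynomial.aeval ![Polynomial.X, 1] f : Polynomial F).IsRoot t := by
  obtain ⟨a, ha⟩ := Projectivization.exists_smul_eq_mk_rep F ![t, 1]
    (fun h => one_ne_zero (congrFun h 1))
  have heval : (Polynomial.evalRingHom t).comp
      (MvPolynomial.aeval ![Polynomial.X, 1] : MvPolynomial (Fin 2) F →ₐ[F] _).toRingHom =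
        MvPolynomial.eval ![t, 1] := by
    ext i
    · simp
    · fin_cases i <;> simp
  rw [affinePoint, ← ha, Units.smul_def, eval_smul_of_isHomogeneous hf,
    mul_eq_zero_iff_left (pow_ne_zero n a.ne_zero), ← heval]
  rfl

theorem finite_setOf_eval_rep_eq_zero {f : MvPolynomial (Fin 2) F} {n : ℕ}
    (hf : f.IsHomogeneous n) (h0 : f ≠ 0) :
    {x : ℙ F (Fin 2 → F) | MvPolynomial.eval x.rep f = 0}.Finite := by
  classical
  have hg : (MvPolynomial.aeval ![Polynomial.X, 1] f : Polynomial F) ≠ 0 := fun hg =>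
    h0 (by rw [← Polynomial.homogenize_eq_of_isHomogeneous hf hg, Polynomial.homogenize_zero])
  refine (((Polynomial.finite_setOfPred_isRoot hg).image affinePoint).insert
    (OnePoint.equivProjectivization F OnePoint.infty)).subset fun x hx => ?_
  obtain ⟨t | t, rfl⟩ := (OnePoint.equivProjectivization F).surjective x
  · exact .inl rfl
  · exact .inr ⟨t, (eval_rep_affinePoint_eq_zero_iff hf t).mp hx, rfl⟩

theorem finite_compl_of_isOpen_zariskiTopology {U : Set (ℙ F (Fin 2 → F))}
    (hU : IsOpen[zariskiTopology F] U) (hne : U.Nonempty) : Uᶜ.Finite := by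
  let _ := zariskiTopology F
  let e := (CofiniteTopology.of (X := ℙ F (Fin 2 → F))).symm
  have he : Continuous e := by
    refine continuous_generateFrom_iff.mpr ?_
    rintro _ ⟨n, f, hf, rfl⟩
    refine CofiniteTopology.isOpen_iff.mpr fun ⟨x, hx⟩ => ?_
    have h0 : f ≠ 0 := fun h0 => hx (by rw [h0, map_zero])
    refine ((finite_setOf_eval_rep_eq_zero hf h0).preimage e.injective.injOn).subset fun y hy => ?_
    exact not_not.mp hy
  have hfin := CofiniteTopology.isOpen_iff.mp (hU.preimage he) (hne.preimage e.surjective)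
  rw [← Set.preimage_compl] at hfin
  exact hfin.of_preimage e.surjective

theorem zariskiDense_of_infinite {S : Set (ℙ F (Fin 2 → F))} (hS : S.Infinite) :
    ZariskiDense S := by
  let _ := zariskiTopology F
  refine dense_iff_inter_open.mpr fun U hU hne => ?_
  obtain ⟨x, hxS, hxU⟩ :=
    hS.exists_notMem_finite (finite_compl_of_isOpen_zariskiTopology hU hne)
  exact ⟨x, not_not.mp hxU, hxS⟩

end ProjectiveLine

section FunctionField

open Polynomial

theorem isIntegral_adjoinRoot {R : Type*} [CommRing R] {P : R[X]} (hP : IsUnit P.leadingCoeff) :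
    Algebra.IsIntegral R (AdjoinRoot P) := by
  obtain ⟨c, hc⟩ := hP.exists_right_inv
  have hroot : IsIntegral R (AdjoinRoot.root P) := by
    refine ⟨C c * P, monic_C_mul_of_mul_leadingCoeff_eq_one ((mul_comm ..).trans hc), ?_⟩
    rw [eval₂_mul, AdjoinRoot.algebraMap_eq, AdjoinRoot.eval₂_root, mul_zero]
  have hle : Algebra.adjoin R {AdjoinRoot.root P} ≤ integralClosure R (AdjoinRoot P) :=
    Algebra.adjoin_le (Set.singleton_subset_iff.mpr hroot)
  rw [AdjoinRoot.adjoinRoot_eq_top] at hle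
  exact ⟨fun _ => hle trivial⟩

theorem injective_of_injective_comp_algebraMap {R A B : Type*} [CommRing R] [Nontrivial R]
    [CommRing A] [IsDomain A] [Algebra R A] [Algebra.IsIntegral R A] [CommRing B] {f : A →+* B}
    (hf : Function.Injective (f.comp (algebraMap R A))) : Function.Injective f := by
  rw [RingHom.injective_iff_ker_eq_bot] at hf ⊢
  exact Ideal.eq_bot_of_comap_eq_bot (R := R) ((RingHom.comap_ker f (algebraMap R A)).trans hf)

variable {F L : Type*} [Field F] [Field L] [Algebra F L]

/-- The functions `x`, `y` are the coordinates of a plane model of a curve with function field `L`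
over `F`. -/
structure IsCoordinatePair (F : Type*) {L : Type*} [Field F] [Field L] [Algebra F L] (x y : L) :
    Prop where
  transcendental : Transcendental F x
  adjoin_eq_top : IntermediateField.adjoin F {x, y} = ⊤

theorem left_mem_adjoin_pair (x y : L) : x ∈ IntermediateField.adjoin F {x, y} :=
  IntermediateField.subset_adjoin _ _ (Set.mem_insert x {y})

theorem right_mem_adjoin_pair (x y : L) : y ∈ IntermediateField.adjoin F {x, y} :=
  IntermediateField.subset_adjoin _ _ (Set.mem_insert_of_mem x rfl)

namespace IsCoordinatePair

variable {x y : L}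

theorem of_mem_adjoin (h : IsCoordinatePair F x y) {x' y' : L} (hx' : Transcendental F x')
    (hx : x ∈ IntermediateField.adjoin F {x', y'}) (hy : y ∈ IntermediateField.adjoin F {x', y'}) :
    IsCoordinatePair F x' y' := by
  refine ⟨hx', ?_⟩
  rw [eq_top_iff, ← h.adjoin_eq_top, IntermediateField.adjoin_le_iff]
  exact Set.insert_subset hx (Set.singleton_subset_iff.mpr hy)

theorem nonempty_fractionRing_adjoinRoot_algEquiv (h : IsCoordinatePair F x y) {P : F[X][X]}
    (hirr : Irreducible P) (hlead : IsUnit P.leadingCoeff)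
    (hP : P.eval₂ (aeval x : F[X] →ₐ[F] L).toRingHom y = 0) :
    Nonempty (FractionRing (AdjoinRoot P) ≃ₐ[F] L) := by
  have : IsDomain (AdjoinRoot P) := AdjoinRoot.isDomain_of_prime hirr.prime
  have := isIntegral_adjoinRoot hlead
  let f : AdjoinRoot P →ₐ[F] L := AdjoinRoot.liftAlgHom P (aeval x) y hP
  have hf_algebraMap (p : F[X]) : f (algebraMap F[X] (AdjoinRoot P) p) = aeval x p :=
    AdjoinRoot.liftAlgHom_of P (aeval x) y hP p
  have hf : Function.Injective f := injective_of_injective_comp_algebraMap (R := F[X])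
    (f := f.toRingHom) <| (injective_iff_map_eq_zero _).mpr fun p hp =>
      transcendental_iff.mp h.transcendental p ((hf_algebraMap p).symm.trans hp)
  let g : FractionRing (AdjoinRoot P) →ₐ[F] L := IsFractionRing.liftAlgHom hf
  have hg (a : AdjoinRoot P) : g (algebraMap _ _ a) = f a := IsFractionRing.lift_algebraMap hf a
  have hg_surjective : Function.Surjective g := by
    rw [← AlgHom.fieldRange_eq_top, eq_top_iff, ← h.adjoin_eq_top, IntermediateField.adjoin_le_iff]
    rintro z (rfl | rfl)
    · exact ⟨_, (hg _).trans ((hf_algebraMap X).trans (aeval_X _))⟩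
    · exact ⟨_, (hg _).trans (AdjoinRoot.liftAlgHom_root ..)⟩
  exact ⟨AlgEquiv.ofBijective g ⟨g.toRingHom.injective, hg_surjective⟩⟩

end IsCoordinatePair

section Weierstrass

theorem baseChange_equation_iff {W : WeierstrassCurve F} {x y : L} :
    (W.baseChange L).toAffine.Equation x y ↔
      y ^ 2 + algebraMap F L W.a₁ * x * y + algebraMap F L W.a₃ * y =
        x ^ 3 + algebraMap F L W.a₂ * x ^ 2 + algebraMap F L W.a₄ * x + algebraMap F L W.a₆ :=
  WeierstrassCurve.Affine.equation_iff ..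

open WeierstrassCurve.Affine (CoordinateRing)

variable (W : WeierstrassCurve.Affine F)

/-- The coordinate function `x` of a Weierstrass curve, as an element of its function field. -/
noncomputable def weierstrassX : W.FunctionField :=
  algebraMap W.CoordinateRing _ (CoordinateRing.mk W (C X))

/-- The coordinate function `y` of a Weierstrass curve, as an element of its function field. -/
noncomputable def weierstrassY : W.FunctionField :=
  algebraMap W.CoordinateRing _ (CoordinateRing.mk W X)

theorem aeval_weierstrassX (p : F[X]) : aeval (weierstrassX W) p =
    algebraMap W.CoordinateRing W.FunctionField (algebraMap F[X] W.CoordinateRing p) := by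
  change aeval (algebraMap W.CoordinateRing W.FunctionField
    (algebraMap F[X] W.CoordinateRing X)) p = _
  rw [aeval_algebraMap_apply, aeval_algebraMap_apply, aeval_X_left_apply]

theorem transcendental_weierstrassX : Transcendental F (weierstrassX W) := by
  rw [transcendental_iff]
  intro p hp
  rw [aeval_weierstrassX, map_eq_zero_iff _ (IsFractionRing.injective _ _)] at hp
  exact (map_eq_zero_iff _ (FaithfulSMul.algebraMap_injective F[X] W.CoordinateRing)).mp hp

theorem algebraMap_coordinateRing_mem_adjoin (a : W.CoordinateRing) :
    algebraMap W.CoordinateRing W.FunctionField a ∈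
      IntermediateField.adjoin F {weierstrassX W, weierstrassY W} := by
  obtain ⟨p, q, rfl⟩ := CoordinateRing.exists_smul_basis_eq a
  have haeval (p : F[X]) : aeval (weierstrassX W) p ∈
      IntermediateField.adjoin F {weierstrassX W, weierstrassY W} :=
    IntermediateField.algebra_adjoin_le_adjoin F _
      (Algebra.adjoin_mono (by simp) (aeval_mem_adjoin_singleton F (weierstrassX W)))
  rw [Algebra.smul_def, Algebra.smul_def, mul_one, map_add, map_mul, ← aeval_weierstrassX,
    ← aeval_weierstrassX]
  exact add_mem (haeval p) (mul_mem (haeval q) (right_mem_adjoin_pair _ _))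

theorem isCoordinatePair_weierstrass : IsCoordinatePair F (weierstrassX W) (weierstrassY W) := by
  refine ⟨transcendental_weierstrassX W, eq_top_iff.mpr fun z _ => ?_⟩
  obtain ⟨a, b, _, rfl⟩ := IsFractionRing.div_surjective (A := W.CoordinateRing) z
  exact div_mem (algebraMap_coordinateRing_mem_adjoin W a)
    (algebraMap_coordinateRing_mem_adjoin W b)

theorem equation_weierstrass : (W.baseChange W.FunctionField).toAffine.Equation
    (weierstrassX W) (weierstrassY W) := by
  have h : algebraMap W.CoordinateRing W.FunctionField (CoordinateRing.mk W W.polynomial) = 0 := by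
    rw [AdjoinRoot.mk_self, map_zero]
  have hC (a : F) : algebraMap W.CoordinateRing W.FunctionField (CoordinateRing.mk W (C (C a))) =
      algebraMap F W.FunctionField a := rfl
  simp only [WeierstrassCurve.Affine.polynomial, map_add, map_mul, map_pow, map_sub, hC] at h
  rw [baseChange_equation_iff, weierstrassX, weierstrassY]
  linear_combination h

end Weierstrass

theorem IsCoordinatePair.exists_of_variableChange {W : WeierstrassCurve F} {X Y : L}
    (h : IsCoordinatePair F X Y) (hW : (W.baseChange L).toAffine.Equation X Y)
    (C : WeierstrassCurve.VariableChange F) : ∃ x y : L, IsCoordinatePair F x y ∧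
      ((C • W).baseChange L).toAffine.Equation x y := by
  let φ := algebraMap F L
  have hu : φ ↑C.u⁻¹ * φ ↑C.u = 1 := by rw [← map_mul]; simp
  obtain ⟨x, hx⟩ : ∃ x, x = φ ↑C.u⁻¹ ^ 2 * (X - φ C.r) := ⟨_, rfl⟩
  obtain ⟨y, hy⟩ : ∃ y, y = φ ↑C.u⁻¹ ^ 3 * (Y - φ C.s * (X - φ C.r) - φ C.t) := ⟨_, rfl⟩
  have hX : X = φ C.u ^ 2 * x + φ C.r := by
    linear_combination -φ ↑C.u ^ 2 * hx - (X - φ C.r) * (φ ↑C.u⁻¹ * φ ↑C.u + 1) * hu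
  have hY : Y = φ C.u ^ 3 * y + φ C.s * (X - φ C.r) + φ C.t := by
    linear_combination -φ ↑C.u ^ 3 * hy - (Y - φ C.s * (X - φ C.r) - φ C.t) *
      ((φ ↑C.u⁻¹ * φ ↑C.u) ^ 2 + φ ↑C.u⁻¹ * φ ↑C.u + 1) * hu
  have hx_transcendental : Transcendental F x := fun hx_alg => h.transcendental <| hX ▸
    (((isAlgebraic_algebraMap _).pow 2).mul hx_alg).add (isAlgebraic_algebraMap _)
  have hφ_mem (a : F) : φ a ∈ IntermediateField.adjoin F {x, y} :=
    IntermediateField.algebraMap_mem _ a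
  have hX_mem : X ∈ IntermediateField.adjoin F {x, y} :=
    hX ▸ add_mem (mul_mem (pow_mem (hφ_mem _) 2) (left_mem_adjoin_pair x y)) (hφ_mem _)
  have hY_mem : Y ∈ IntermediateField.adjoin F {x, y} :=
    hY ▸ add_mem (add_mem (mul_mem (pow_mem (hφ_mem _) 3) (right_mem_adjoin_pair x y))
      (mul_mem (hφ_mem _) (sub_mem hX_mem (hφ_mem _)))) (hφ_mem _)
  refine ⟨x, y, h.of_mem_adjoin hx_transcendental hX_mem hY_mem, ?_⟩
  rw [baseChange_equation_iff] at hW ⊢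
  simp only [WeierstrassCurve.variableChange_a₁, WeierstrassCurve.variableChange_a₂,
    WeierstrassCurve.variableChange_a₃, WeierstrassCurve.variableChange_a₄,
    WeierstrassCurve.variableChange_a₆, map_mul, map_add, map_sub, map_pow, map_ofNat, hx, hy, φ]
  linear_combination algebraMap F L ↑C.u⁻¹ ^ 6 * hW

/-- The Weierstrass curve `y² = (x + β)(x² - 4αγ)`, the Jacobian of the curve of genus one
`w² = αu⁴ + βu² + γ`. -/
def biquadraticJacobian (α β γ : F) : WeierstrassCurve F where
  a₁ := 0
  a₂ := β
  a₃ := 0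
  a₄ := -4 * α * γ
  a₆ := -4 * α * γ * β

theorem biquadraticJacobian_discr (α β γ : F) :
    (biquadraticJacobian α β γ).Δ = 256 * α * γ * (β ^ 2 - 4 * α * γ) ^ 2 := by
  simp only [biquadraticJacobian, WeierstrassCurve.Δ, WeierstrassCurve.b₂, WeierstrassCurve.b₄,
    WeierstrassCurve.b₆, WeierstrassCurve.b₈]
  ring

theorem biquadraticJacobian_c₄ (α β γ : F) :
    (biquadraticJacobian α β γ).c₄ = 16 * (β ^ 2 + 12 * α * γ) := by
  simp only [biquadraticJacobian, WeierstrassCurve.c₄, WeierstrassCurve.b₂, WeierstrassCurve.b₄]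
  ring

section Biquadratic

variable {s β γ : F} {x y : L}

theorem biquadraticJacobian_equation_iff :
    ((biquadraticJacobian (s ^ 2) β γ).baseChange L).toAffine.Equation x y ↔
      y ^ 2 = (x + algebraMap F L β) *
        (x ^ 2 - 4 * algebraMap F L s ^ 2 * algebraMap F L γ) := by
  rw [baseChange_equation_iff]
  simp only [biquadraticJacobian, map_mul, map_neg, map_pow, map_zero, map_ofNat]
  constructor <;> intro h <;> linear_combination h

theorem exists_biquadratic_of_jacobian [NeZero (2 : L)] (hs : s ≠ 0)
    (hx : x + algebraMap F L β ≠ 0)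
    (h : ((biquadraticJacobian (s ^ 2) β γ).baseChange L).toAffine.Equation x y) :
    ∃ u w : L, w ^ 2 = algebraMap F L s ^ 2 * u ^ 4 + algebraMap F L β * u ^ 2 + algebraMap F L γ ∧
      x = 2 * algebraMap F L s * (w + algebraMap F L s * u ^ 2) ∧
      y = 2 * algebraMap F L s * (x + algebraMap F L β) * u := by
  have h2 : (2 : L) ≠ 0 := two_ne_zero
  have hφs : algebraMap F L s ≠ 0 := (_root_.map_ne_zero _).mpr hs
  rw [biquadraticJacobian_equation_iff] at h
  generalize algebraMap F L s = s, algebraMap F L β = β, algebraMap F L γ = γ at *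
  obtain ⟨u, hu⟩ : ∃ u, y = 2 * s * (x + β) * u :=
    ⟨y / (2 * s * (x + β)), by field_simp⟩
  obtain ⟨w, hw⟩ : ∃ w, x = 2 * s * (w + s * u ^ 2) :=
    ⟨x / (2 * s) - s * u ^ 2, by field_simp; ring⟩
  have hu_sq : 4 * s ^ 2 * (x + β) * u ^ 2 = x ^ 2 - 4 * s ^ 2 * γ :=
    mul_left_cancel₀ hx (by rw [← h, hu]; ring)
  refine ⟨u, w, mul_left_cancel₀ (pow_ne_zero 2 (mul_ne_zero h2 hφs)) ?_, hw, hu⟩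
  rw [hw] at hu_sq
  linear_combination -hu_sq

theorem IsCoordinatePair.exists_biquadratic [NeZero (2 : F)] (h : IsCoordinatePair F x y)
    (hs : s ≠ 0)
    (heq : ((biquadraticJacobian (s ^ 2) β γ).baseChange L).toAffine.Equation x y) :
    ∃ u w : L, IsCoordinatePair F u w ∧ w ^ 2 = algebraMap F L s ^ 2 * u ^ 4 +
      algebraMap F L β * u ^ 2 + algebraMap F L γ := by
  have : NeZero (2 : L) := ⟨map_ofNat (algebraMap F L) 2 ▸ (_root_.map_ne_zero _).mpr two_ne_zero⟩
  have hφ_alg (a : F) : IsAlgebraic F (algebraMap F L a) := isAlgebraic_algebraMap a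
  have h2_alg : IsAlgebraic F (2 : L) := map_ofNat (algebraMap F L) 2 ▸ hφ_alg 2
  have hxβ : x + algebraMap F L β ≠ 0 := fun h0 =>
    h.transcendental (eq_neg_of_add_eq_zero_left h0 ▸ (hφ_alg β).neg)
  obtain ⟨u, w, hw_sq, hx, hy⟩ := exists_biquadratic_of_jacobian hs hxβ heq
  have hu_transcendental : Transcendental F u := fun hu_alg => by
    have hw_alg : IsAlgebraic F w := IsAlgebraic.of_pow two_pos <| hw_sq ▸
      ((((hφ_alg s).pow 2).mul (hu_alg.pow 4)).add ((hφ_alg β).mul (hu_alg.pow 2))).add (hφ_alg γ)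
    exact h.transcendental <| hx ▸
      (h2_alg.mul (hφ_alg s)).mul (hw_alg.add ((hφ_alg s).mul (hu_alg.pow 2)))
  have hφ_mem (a : F) : algebraMap F L a ∈ IntermediateField.adjoin F {u, w} :=
    IntermediateField.algebraMap_mem _ a
  have h2s_mem : 2 * algebraMap F L s ∈ IntermediateField.adjoin F {u, w} :=
    mul_mem (map_ofNat (algebraMap F L) 2 ▸ hφ_mem 2) (hφ_mem s)
  have hu_mem := left_mem_adjoin_pair (F := F) u w
  have hx_mem : x ∈ IntermediateField.adjoin F {u, w} := hx ▸ mul_mem h2s_mem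
    (add_mem (right_mem_adjoin_pair u w) (mul_mem (hφ_mem s) (pow_mem hu_mem 2)))
  have hy_mem : y ∈ IntermediateField.adjoin F {u, w} :=
    hy ▸ mul_mem (mul_mem h2s_mem (add_mem hx_mem (hφ_mem β))) hu_mem
  exact ⟨u, w, h.of_mem_adjoin hu_transcendental hx_mem hy_mem, hw_sq⟩

end Biquadratic

end FunctionField

namespace CausalPencil

section Field

variable {F K : Type*} [Field F] [Field K]

theorem isSmooth_iff {V : CausalPencil F} : V.IsSmooth ↔
    V.Delta ≠ 0 ∧ V.mu ≠ 0 ∧ V.masterA ≠ 0 ∧ V.delta ^ 2 + 4 * V.Delta ≠ 0 := by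
  simp [IsSmooth, masterA, and_assoc]

namespace IsSmooth

variable {V : CausalPencil F} (h : V.IsSmooth)
include h

theorem Delta_ne_zero : V.Delta ≠ 0 := (isSmooth_iff.mp h).1

theorem mu_ne_zero : V.mu ≠ 0 := (isSmooth_iff.mp h).2.1

theorem masterA_ne_zero : V.masterA ≠ 0 := (isSmooth_iff.mp h).2.2.1

theorem delta_sq_add_ne_zero : V.delta ^ 2 + 4 * V.Delta ≠ 0 := (isSmooth_iff.mp h).2.2.2

end IsSmooth

/-- The image of a pencil under a homomorphism of the coefficient fields. -/
def map (f : F →+* K) (V : CausalPencil F) : CausalPencil K := ⟨f V.a, f V.b, f V.d⟩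

section Map

variable (f : F →+* K) (V : CausalPencil F)

@[simp] theorem tau_map : (V.map f).tau = f V.tau := by simp [map, tau]

@[simp] theorem delta_map : (V.map f).delta = f V.delta := by simp [map, delta]

@[simp] theorem Delta_map : (V.map f).Delta = f V.Delta := by simp [map, Delta]

@[simp] theorem mu_map : (V.map f).mu = f V.mu := by simp [map, mu]

@[simp] theorem masterA_map : (V.map f).masterA = f V.masterA := by
  rw [masterA, masterA, tau_map, Delta_map, map_sub, map_pow, map_mul, map_ofNat]

@[simp] theorem jMap_map : (V.map f).jMap = f V.jMap := by
  simp only [jMap, tau_map, delta_map, Delta_map, mu_map, map_div₀, map_mul, map_add, map_sub,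
    map_pow, map_ofNat]

end Map

/-- A smooth pencil is nondegenerate if `τ ≠ 0` and, for every norm `q`, the two lower coefficients
of the master quadratic do not vanish together, whatever the trace is. The inequality `master` is
the one obtained by eliminating the trace, see `masterA_sq_mul_eq`. -/
structure IsNondegenerate (V : CausalPencil F) : Prop where
  isSmooth : V.IsSmooth
  tau_ne_zero : V.tau ≠ 0
  master (q : ℕ) (hq : 1 < q) :
    V.masterA ^ 2 * (1 + (q : F)⁻¹) ≠ 2 * V.delta ^ 2 * (V.masterA + 2 * V.Delta)

theorem IsSmooth.map {V : CausalPencil F} (h : V.IsSmooth) (f : F →+* K) : (V.map f).IsSmooth := by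
  unfold IsSmooth
  simpa only [tau_map, delta_map, Delta_map, mu_map, map_mul, map_add, map_sub, map_pow, map_ofNat]
    using (map_ne_zero f).mpr h

theorem IsNondegenerate.map {V : CausalPencil F} (h : V.IsNondegenerate) (f : F →+* K) :
    (V.map f).IsNondegenerate where
  isSmooth := h.isSmooth.map f
  tau_ne_zero := by simpa using h.tau_ne_zero
  master q hq := by
    simpa only [masterA_map, delta_map, Delta_map, map_mul, map_add, map_pow, map_inv₀, map_one,
      map_natCast, map_ofNat] using f.injective.ne (h.master q hq)

theorem masterA_sq_mul_eq {V : CausalPencil F} {t q : F} (hτ : V.tau ≠ 0)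
    (hB : V.masterB t q = 0) (hC : V.masterC t q = 0) :
    V.masterA ^ 2 * (1 + q⁻¹) = 2 * V.delta ^ 2 * (V.masterA + 2 * V.Delta) := by
  obtain ⟨r, hr⟩ : ∃ r, r = t * q⁻¹ := ⟨_, rfl⟩
  have hB' : r * V.masterA = 2 * V.delta * V.tau := by
    rw [masterB] at hB
    rw [hr]
    linear_combination -hB
  have hC' : V.tau ^ 2 * (1 + q⁻¹) = r * V.delta * V.tau + V.Delta * r ^ 2 := by
    rw [masterC] at hC
    rw [hr]
    linear_combination hC
  apply mul_left_cancel₀ (pow_ne_zero 2 hτ)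
  linear_combination V.masterA ^ 2 * hC' +
    (V.masterA * V.delta * V.tau + V.Delta * (r * V.masterA + 2 * V.delta * V.tau)) * hB'

theorem IsNondegenerate.masterB_ne_zero_or_masterC_ne_zero {V : CausalPencil F}
    (h : V.IsNondegenerate) {q : ℕ} (hq : 1 < q) (t : F) :
    V.masterB t q ≠ 0 ∨ V.masterC t q ≠ 0 := by
  by_contra! hBC
  exact h.master q hq (masterA_sq_mul_eq h.tau_ne_zero hBC.1 hBC.2)

end Field

section OfTauDelta

variable {F : Type*} [Field F]

/-- The pencil with trace `τ`, diagonal difference `δ` and `b = 1/2`. Scaling `V` only rescales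
`λ`, so fixing `b` loses no spectral curve. -/
def ofTauDelta (τ δ : F) : CausalPencil F := ⟨(τ + δ) / 2, 1 / 2, (τ - δ) / 2⟩

variable [CharZero F]

@[simp] theorem tau_ofTauDelta (τ δ : F) : (ofTauDelta τ δ).tau = τ := by
  simp only [ofTauDelta, tau]; ring

@[simp] theorem delta_ofTauDelta (τ δ : F) : (ofTauDelta τ δ).delta = δ := by
  simp only [ofTauDelta, delta]; ring

@[simp] theorem Delta_ofTauDelta (τ δ : F) :
    (ofTauDelta τ δ).Delta = (τ ^ 2 - δ ^ 2 + 1) / 4 := by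
  simp only [ofTauDelta, Delta]; ring

@[simp] theorem mu_ofTauDelta (τ δ : F) : (ofTauDelta τ δ).mu = -1 / 4 := by
  simp only [ofTauDelta, mu]; ring

@[simp] theorem masterA_ofTauDelta (τ δ : F) : (ofTauDelta τ δ).masterA = δ ^ 2 - 1 := by
  rw [masterA, tau_ofTauDelta, Delta_ofTauDelta]; ring

theorem delta_sq_add_ofTauDelta (τ δ : F) : δ ^ 2 + 4 * (ofTauDelta τ δ).Delta = τ ^ 2 + 1 := by
  rw [Delta_ofTauDelta]; ring

end OfTauDelta

/-- Parameters of a pencil `ofTauDelta τ δ`: here `c` is the invariant `β² / 4αγ` of the quartic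
`w² = αu⁴ + βu² + γ` attached to the spectral curve, `T = τ²`, and `m` encodes `δ²` by
`δ² = m / (T + m)`. In these coordinates `jMap` depends on `c` only, which leaves `T` free to be
chosen so that the pencil is nondegenerate. -/
structure IsAdmissible {F : Type*} [Field F] (c T m : F) : Prop where
  T_ne_zero : T ≠ 0
  T_add_one_ne_zero : T + 1 ≠ 0
  T_add_m_ne_zero : T + m ≠ 0
  m_eq : m = -c * (T + 1)
  master (q : ℕ) (hq : 1 < q) : T * (1 + (q : F)⁻¹) ≠ m * (m + T - 1)

namespace IsAdmissible

variable {F : Type*} [Field F] {c τ δ m : F}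

theorem delta_sq_sub_one (h : IsAdmissible c (τ ^ 2) m) (hδ : δ ^ 2 = m / (τ ^ 2 + m)) :
    δ ^ 2 - 1 = -τ ^ 2 / (τ ^ 2 + m) := by
  have := h.T_add_m_ne_zero
  rw [hδ]
  field_simp
  ring

theorem delta_sq_sub_one_ne_zero (h : IsAdmissible c (τ ^ 2) m) (hδ : δ ^ 2 = m / (τ ^ 2 + m)) :
    δ ^ 2 - 1 ≠ 0 := by
  rw [h.delta_sq_sub_one hδ]
  exact div_ne_zero (neg_ne_zero.mpr h.T_ne_zero) h.T_add_m_ne_zero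

variable [CharZero F]

theorem Delta_ofTauDelta_eq (h : IsAdmissible c (τ ^ 2) m) (hδ : δ ^ 2 = m / (τ ^ 2 + m)) :
    (ofTauDelta τ δ).Delta = (c - 1) * ((δ ^ 2 - 1) * (τ ^ 2 + 1)) / 4 := by
  have hratio : τ ^ 2 * δ ^ 2 = c * ((δ ^ 2 - 1) * (τ ^ 2 + 1)) := by
    rw [h.delta_sq_sub_one hδ, hδ]
    linear_combination τ ^ 2 / (τ ^ 2 + m) * h.m_eq
  rw [Delta_ofTauDelta]
  linear_combination hratio / 4

theorem isSmooth_ofTauDelta (h : IsAdmissible c (τ ^ 2) m) (hδ : δ ^ 2 = m / (τ ^ 2 + m))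
    (hc : c ≠ 1) : (ofTauDelta τ δ).IsSmooth := by
  have hA := h.delta_sq_sub_one_ne_zero hδ
  have hT := h.T_add_one_ne_zero
  refine isSmooth_iff.mpr ⟨?_, ?_, ?_, ?_⟩
  · rw [h.Delta_ofTauDelta_eq hδ]
    exact div_ne_zero (mul_ne_zero (sub_ne_zero.mpr hc) (mul_ne_zero hA hT)) (by norm_num)
  · rw [mu_ofTauDelta]
    norm_num
  · rwa [masterA_ofTauDelta]
  · rwa [delta_ofTauDelta, delta_sq_add_ofTauDelta]

theorem jMap_ofTauDelta (h : IsAdmissible c (τ ^ 2) m) (hδ : δ ^ 2 = m / (τ ^ 2 + m))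
    (hc : c ≠ 1) : (ofTauDelta τ δ).jMap = 64 * (3 + c) ^ 3 / (1 - c) ^ 2 := by
  have hA := h.delta_sq_sub_one_ne_zero hδ
  have hT := h.T_add_one_ne_zero
  have hc' : c - 1 ≠ 0 := sub_ne_zero.mpr hc
  obtain ⟨p, hp⟩ : ∃ p, p = (δ ^ 2 - 1) * (τ ^ 2 + 1) := ⟨_, rfl⟩
  have hp0 : p ≠ 0 := hp ▸ mul_ne_zero hA hT
  have hΔ : (ofTauDelta τ δ).Delta = (c - 1) * p / 4 := hp ▸ h.Delta_ofTauDelta_eq hδ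
  have hratio : τ ^ 2 * δ ^ 2 = c * p := by
    rw [Delta_ofTauDelta] at hΔ
    linear_combination 4 * hΔ - hp
  have hden : (τ ^ 2 - 4 * (ofTauDelta τ δ).Delta) * (δ ^ 2 + 4 * (ofTauDelta τ δ).Delta) = p := by
    rw [hp, Delta_ofTauDelta]
    ring
  rw [jMap, tau_ofTauDelta, delta_ofTauDelta, mu_ofTauDelta, mul_assoc _ (_ - _), hden, hΔ, hratio,
    ← neg_sq (1 - c), neg_sub]
  field_simp
  ring

theorem isNondegenerate_ofTauDelta (h : IsAdmissible c (τ ^ 2) m)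
    (hδ : δ ^ 2 = m / (τ ^ 2 + m)) (hc : c ≠ 1) : (ofTauDelta τ δ).IsNondegenerate where
  isSmooth := h.isSmooth_ofTauDelta hδ hc
  tau_ne_zero := by
    rw [tau_ofTauDelta]
    exact fun h0 => h.T_ne_zero (by simp [h0])
  master q hq heq := by
    rw [masterA_ofTauDelta, delta_ofTauDelta, Delta_ofTauDelta] at heq
    have hD := h.delta_sq_sub_one hδ
    rw [eq_div_iff h.T_add_m_ne_zero] at hD hδ
    have heq' : ((δ ^ 2 - 1) * (τ ^ 2 + m)) ^ 2 * (1 + (q : F)⁻¹) =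
        δ ^ 2 * (τ ^ 2 + m) * (τ ^ 2 * (τ ^ 2 + m) + (δ ^ 2 - 1) * (τ ^ 2 + m)) := by
      linear_combination (τ ^ 2 + m) ^ 2 * heq
    rw [hD, hδ] at heq'
    exact h.master q hq (mul_left_cancel₀ h.T_ne_zero (by linear_combination heq'))

end IsAdmissible

section Existence

theorem one_add_natCast_inv_ne_zero {F : Type*} [Field F] [CharZero F] {q : ℕ} (hq : 1 < q) :
    1 + (q : F)⁻¹ ≠ 0 := by
  have hq' : (q : F) ≠ 0 := by exact_mod_cast hq.ne_bot
  intro h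
  field_simp at h
  exact q.succ_ne_zero (by exact_mod_cast h)

theorem isAdmissible_of_sq_ne_one {F : Type*} [Field F] [CharZero F] {c : F} (hc : c ≠ 1)
    (hc' : c ≠ -1) : IsAdmissible c ((1 + c) / (1 - c)) (-2 * c / (1 - c)) := by
  have h1 : 1 - c ≠ 0 := sub_ne_zero.mpr hc.symm
  have h2 : 1 + c ≠ 0 := fun h => hc' (eq_neg_of_add_eq_zero_right h)
  have hT : (1 + c) / (1 - c) + 1 = 2 / (1 - c) := by field_simp; ring
  have hTm : (1 + c) / (1 - c) + -2 * c / (1 - c) = 1 := by field_simp; ring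
  refine ⟨div_ne_zero h2 h1, ?_, ?_, ?_, fun q hq => ?_⟩
  · exact hT ▸ div_ne_zero two_ne_zero h1
  · exact hTm.trans_ne one_ne_zero
  · rw [hT]
    ring
  · rw [add_comm (-2 * c / (1 - c)), hTm, sub_self, mul_zero]
    exact mul_ne_zero (div_ne_zero h2 h1) (one_add_natCast_inv_ne_zero hq)

theorem isAdmissible_neg_one {F : Type*} [Field F] [CharZero F] : IsAdmissible (-1 : F) 1 2 := by
  refine ⟨one_ne_zero, by norm_num, by norm_num, by norm_num, fun q hq h => ?_⟩
  have hq' : (q : F) ≠ 0 := by exact_mod_cast hq.ne_bot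
  field_simp at h
  have h' : q + 1 = 4 * q := by
    have : (q + 1 : F) = 4 * q := by linear_combination h
    exact_mod_cast this
  omega

section Ordered

variable {R : Type*} [Field R] [LinearOrder R] [IsStrictOrderedRing R] {c : R}

theorem one_add_natCast_inv_lt_two {q : ℕ} (hq : 1 < q) : 1 + (q : R)⁻¹ < 2 := by
  have : (q : R)⁻¹ < 1 := inv_lt_one_of_one_lt₀ (by exact_mod_cast hq)
  linarith

theorem isAdmissible_of_pos (hc : 0 < c) : IsAdmissible c (c / 2) (-c * (c / 2 + 1)) where
  T_ne_zero := by positivity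
  T_add_one_ne_zero := by positivity
  T_add_m_ne_zero := by nlinarith
  m_eq := rfl
  master q hq := by
    refine ne_of_lt ?_
    calc c / 2 * (1 + (q : R)⁻¹) < c / 2 * 2 :=
          mul_lt_mul_of_pos_left (one_add_natCast_inv_lt_two hq) (by positivity)
      _ < c * (c / 2 + 1) * (c / 2 * (1 + c) + 1) := by
          have : 0 < c ^ 2 := by positivity
          have : 0 < c ^ 3 := by positivity
          nlinarith [pow_pos hc 4]
      _ = _ := by ring

theorem isAdmissible_of_le_neg_one (hc : c ≤ -1) : IsAdmissible c 1 (-c * (1 + 1)) where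
  T_ne_zero := one_ne_zero
  T_add_one_ne_zero := by positivity
  T_add_m_ne_zero := by linarith
  m_eq := rfl
  master q hq := by
    refine ne_of_lt ?_
    calc 1 * (1 + (q : R)⁻¹) < 2 := by linarith [one_add_natCast_inv_lt_two (R := R) hq]
      _ ≤ (-c * (1 + 1)) * (-c * (1 + 1) + 1 - 1) := by nlinarith

theorem exists_nonneg_isAdmissible (hc : c ≠ 1) :
    ∃ T m, IsAdmissible c T m ∧ 0 ≤ T ∧ 0 ≤ m / (T + m) := by
  rcases lt_or_ge 0 c with hpos | hnonpos
  · refine ⟨_, _, isAdmissible_of_pos hpos, by positivity, div_nonneg_of_nonpos ?_ ?_⟩ <;> nlinarith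
  rcases lt_or_ge (-1) c with hlt | hle
  · refine ⟨_, _, isAdmissible_of_sq_ne_one hc hlt.ne', ?_, ?_⟩
    · exact div_nonneg (by linarith) (by linarith)
    · rw [← add_div]
      exact div_nonneg (div_nonneg (by linarith) (by linarith))
        (div_nonneg (by linarith) (by linarith))
  · exact ⟨_, _, isAdmissible_of_le_neg_one hle, zero_le_one,
      div_nonneg (by linarith) (by linarith)⟩

end Ordered

theorem exists_isAdmissible {F : Type*} [Field F] [CharZero F] {c : F} (hc : c ≠ 1) :
    ∃ T m, IsAdmissible c T m := by
  rcases eq_or_ne c (-1) with rfl | hc'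
  · exact ⟨_, _, isAdmissible_neg_one⟩
  · exact ⟨_, _, isAdmissible_of_sq_ne_one hc hc'⟩

open Polynomial in
theorem exists_ne_one_jInvariant_eq {F : Type*} [Field F] [CharZero F]
    (hroot : ∀ p : F[X], p.natDegree = 3 → ∃ c, p.IsRoot c) (j : F) :
    ∃ c ≠ 1, 64 * (3 + c) ^ 3 / (1 - c) ^ 2 = j := by
  obtain ⟨c, hc⟩ := hroot (64 * (3 + X) ^ 3 - C j * (1 - X) ^ 2) <| by
    compute_degree!
  replace hc : 64 * (3 + c) ^ 3 - j * (1 - c) ^ 2 = 0 := by simpa using hc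
  have hc1 : c ≠ 1 := by
    rintro rfl
    norm_num at hc
  refine ⟨c, hc1, ?_⟩
  rw [div_eq_iff (pow_ne_zero 2 (sub_ne_zero.mpr hc1.symm))]
  linear_combination hc

theorem exists_isNondegenerate_jMap_eq {F : Type*} [Field F] [CharZero F] [IsAlgClosed F] (j : F) :
    ∃ V : CausalPencil F, V.IsNondegenerate ∧ V.jMap = j := by
  obtain ⟨c, hc, rfl⟩ := exists_ne_one_jInvariant_eq
    (fun p hp => IsAlgClosed.exists_root p
      (Polynomial.natDegree_pos_iff_degree_pos.mp (by omega)).ne') j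
  obtain ⟨T, m, h⟩ := exists_isAdmissible hc
  obtain ⟨τ, rfl⟩ := IsAlgClosed.exists_pow_nat_eq T two_pos
  obtain ⟨δ, hδ⟩ := IsAlgClosed.exists_pow_nat_eq (m / (τ ^ 2 + m)) two_pos
  exact ⟨_, h.isNondegenerate_ofTauDelta hδ hc, h.jMap_ofTauDelta hδ hc⟩

theorem exists_isNondegenerate_jMap_eq_of_isRealClosed {R : Type*} [Field R] [LinearOrder R]
    [IsStrictOrderedRing R] [IsRealClosed R] (j : R) :
    ∃ V : CausalPencil R, V.IsNondegenerate ∧ V.jMap = j := by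
  obtain ⟨c, hc, rfl⟩ := exists_ne_one_jInvariant_eq
    (fun p hp => IsRealClosed.exists_isRoot_of_odd_natDegree (by rw [hp]; decide)) j
  obtain ⟨T, m, h, hT, hδ⟩ := exists_nonneg_isAdmissible hc
  obtain ⟨τ, rfl⟩ := IsRealClosed.exists_eq_pow_of_nonneg hT two_ne_zero
  obtain ⟨δ, hδ⟩ := IsRealClosed.exists_eq_pow_of_nonneg hδ two_ne_zero
  exact ⟨_, h.isNondegenerate_ofTauDelta hδ.symm hc, h.jMap_ofTauDelta hδ.symm hc⟩

end Existence

end CausalPencil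

section Irreducible

open Polynomial

theorem irreducible_quadratic_of_not_isSquare_discrim {R : Type*} [CommRing R] [IsDomain R]
    {a b c : R} (ha : IsUnit a) (h : ¬IsSquare (discrim a b c)) :
    Irreducible (C a * X ^ 2 + C b * X + C c) := by
  obtain ⟨d, hda⟩ := ha.exists_left_inv
  have hd : IsUnit (C d) := (IsUnit.of_mul_eq_one a hda).map C
  have hlead : (C d * (C a * X ^ 2 + C b * X + C c)).Monic :=
    monic_C_mul_of_mul_leadingCoeff_eq_one (by rw [leadingCoeff_quadratic ha.ne_zero, hda])
  have hdeg : (C d * (C a * X ^ 2 + C b * X + C c)).natDegree = 2 := by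
    rw [natDegree_C_mul (C_ne_zero.mp hd.ne_zero), natDegree_quadratic ha.ne_zero]
  rw [← irreducible_isUnit_mul hd,
    hlead.irreducible_iff_roots_eq_zero_of_degree_le_three hdeg.ge (by omega),
    Multiset.eq_zero_iff_forall_notMem]
  intro x hx
  have hroot : a * (x * x) + b * x + c = 0 := by
    have := isRoot_of_mem_roots hx
    rw [IsRoot, eval_mul, eval_C, mul_eq_zero_iff_left (C_ne_zero.mp hd.ne_zero)] at this
    simpa [pow_two] using this
  exact h ⟨2 * a * x + b, by rw [discrim_eq_sq_of_quadratic_eq_zero hroot, pow_two]⟩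

theorem sq_ne_biquadratic {F : Type*} [Field F] [NeZero (2 : F)] {α β γ : F} (hα : α ≠ 0)
    (hd : discrim α β γ ≠ 0) (g : F[X]) : g ^ 2 ≠ C α * X ^ 4 + C β * X ^ 2 + C γ := by
  intro h
  have hdeg : g.natDegree ≤ 2 := by
    have h1 : (g ^ 2).natDegree ≤ 4 := by
      rw [h]
      compute_degree
    rw [natDegree_pow] at h1
    omega
  obtain ⟨a, b, c, rfl⟩ : ∃ a b c, g = C a * X ^ 2 + C b * X + C c :=
    ⟨_, _, _, eq_quadratic_of_degree_le_two (natDegree_le_iff_degree_le.mp hdeg)⟩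
  have hexp : (C a * X ^ 2 + C b * X + C c : F[X]) ^ 2 = C (a ^ 2) * X ^ 4 + C (2 * a * b) * X ^ 3 +
      C (b ^ 2 + 2 * a * c) * X ^ 2 + C (2 * b * c) * X + C (c ^ 2) := by
    simp only [C_mul, C_add, C_pow, C_ofNat]
    ring
  have hcoeff (n : ℕ) := congrArg (coeff · n) (hexp.symm.trans h)
  have h4 : a ^ 2 = α := by simpa [-map_mul, -map_add, -map_pow, coeff_X, coeff_C] using hcoeff 4
  have h3 : 2 * a * b = 0 := by
    simpa [-map_mul, -map_add, -map_pow, coeff_X, coeff_C] using hcoeff 3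
  have h2 : b ^ 2 + 2 * a * c = β := by
    simpa [-map_mul, -map_add, -map_pow, coeff_X, coeff_C] using hcoeff 2
  have h0 : c ^ 2 = γ := by simpa [-map_mul, -map_add, -map_pow, coeff_X, coeff_C] using hcoeff 0
  have ha : a ≠ 0 := fun ha => hα (by rw [← h4, ha, zero_pow two_ne_zero])
  obtain rfl : b = 0 := by simpa [ha, two_ne_zero] using h3
  apply hd
  rw [discrim, ← h4, ← h2, ← h0]
  ring

end Irreducible

namespace CausalPencil

section SpectralCurve

open Polynomial

variable {F : Type*} [Field F] {V : CausalPencil F}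

theorem spectralPoly_eq (V : CausalPencil F) :
    V.spectralPoly = C (C V.Delta) * X ^ 2 + C (-(X * (C V.tau * X ^ 2 + C V.delta))) * X +
      C (X ^ 6 - X ^ 2) := by
  have hmatrix : (C X : F[X][X]) ^ 3 • (1 : Matrix (Fin 2) (Fin 2) F[X][X]) -
      (C X : F[X][X]) • systemOp F[X][X] - (X : F[X][X]) • V.coupling.map (fun x => C (C x)) =
        !![C X ^ 3 - C X - X * C (C V.a), -(X * C (C V.b));
          X * C (C V.b), C X ^ 3 + C X - X * C (C V.d)] := by
    ext i j : 1
    fin_cases i <;> fin_cases j <;> simp [systemOp, coupling] <;> ring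
  rw [spectralPoly, hmatrix, Matrix.det_fin_two_of]
  simp only [tau, delta, Delta, C_add, C_sub, C_mul, C_pow, C_neg]
  ring

theorem eval₂_spectralPoly {L : Type*} [Field L] [Algebra F L] (V : CausalPencil F) (u l : L) :
    V.spectralPoly.eval₂ (aeval u : F[X] →ₐ[F] L).toRingHom l =
      algebraMap F L V.Delta * l ^ 2 -
        u * (algebraMap F L V.tau * u ^ 2 + algebraMap F L V.delta) * l + (u ^ 6 - u ^ 2) := by
  rw [spectralPoly_eq, eval₂_add, eval₂_add, eval₂_mul, eval₂_mul, eval₂_C, eval₂_C, eval₂_C,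
    eval₂_X_pow, eval₂_X]
  simp only [AlgHom.toRingHom_eq_coe, RingHom.coe_coe, aeval_C, aeval_X, map_neg, map_mul,
    map_add, map_pow, map_sub]
  ring

theorem discrim_masterA (V : CausalPencil F) :
    discrim V.masterA (2 * V.tau * V.delta) (V.delta ^ 2 + 4 * V.Delta) =
      -64 * V.Delta * V.mu := by
  simp only [discrim, masterA, tau, delta, Delta, mu]
  ring

theorem IsSmooth.discrim_masterA_ne_zero [NeZero (2 : F)] (h : V.IsSmooth) :
    discrim V.masterA (2 * V.tau * V.delta) (V.delta ^ 2 + 4 * V.Delta) ≠ 0 := by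
  have h64 : (-64 : F) ≠ 0 := by
    rw [show (-64 : F) = -2 ^ 6 by norm_num]
    exact neg_ne_zero.mpr (pow_ne_zero 6 two_ne_zero)
  rw [discrim_masterA]
  exact mul_ne_zero (mul_ne_zero h64 h.Delta_ne_zero) h.mu_ne_zero

theorem IsSmooth.irreducible_spectralPoly [NeZero (2 : F)] (h : V.IsSmooth) :
    Irreducible V.spectralPoly := by
  rw [spectralPoly_eq]
  refine irreducible_quadratic_of_not_isSquare_discrim (h.Delta_ne_zero.isUnit.map C) ?_
  rintro ⟨f, hf⟩
  have hdiscrim : f ^ 2 = X ^ 2 * (C V.masterA * X ^ 4 + C (2 * V.tau * V.delta) * X ^ 2 +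
      C (V.delta ^ 2 + 4 * V.Delta)) := by
    rw [pow_two, ← hf, discrim]
    simp only [masterA, C_mul, C_add, C_sub, C_pow, C_ofNat]
    ring
  obtain ⟨g, rfl⟩ : X ∣ f :=
    prime_X.dvd_of_dvd_pow (hdiscrim ▸ (dvd_pow_self X two_ne_zero).mul_right _)
  rw [mul_pow] at hdiscrim
  exact sq_ne_biquadratic h.masterA_ne_zero h.discrim_masterA_ne_zero g
    (mul_left_cancel₀ (pow_ne_zero 2 X_ne_zero) hdiscrim)

/-- The Jacobian of the spectral curve. Completing the square in `λ` turns the spectral curve into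
`w² = αu⁴ + βu² + γ` with `α = τ² - 4Δ`, `β = 2τδ` and `γ = δ² + 4Δ`. -/
def jacobian (V : CausalPencil F) : WeierstrassCurve F :=
  biquadraticJacobian V.masterA (2 * V.tau * V.delta) (V.delta ^ 2 + 4 * V.Delta)

theorem jacobian_discr (V : CausalPencil F) :
    V.jacobian.Δ =
      2 ^ 20 * V.masterA * (V.delta ^ 2 + 4 * V.Delta) * (V.Delta * V.mu) ^ 2 := by
  rw [jacobian, biquadraticJacobian_discr, ← discrim, discrim_masterA]
  ring

theorem jacobian_c₄ (V : CausalPencil F) :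
    V.jacobian.c₄ = 2 ^ 8 * (V.tau ^ 2 * V.delta ^ 2 + 12 * V.Delta * V.mu) := by
  have hdiscrim := V.discrim_masterA
  rw [discrim] at hdiscrim
  rw [jacobian, biquadraticJacobian_c₄]
  linear_combination -48 * hdiscrim

theorem IsSmooth.jacobian_isElliptic [NeZero (2 : F)] (h : V.IsSmooth) :
    V.jacobian.IsElliptic := by
  rw [WeierstrassCurve.isElliptic_iff, jacobian_discr, isUnit_iff_ne_zero]
  have := h.masterA_ne_zero
  have := h.delta_sq_add_ne_zero
  have := h.Delta_ne_zero
  have := h.mu_ne_zero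
  have : (2 : F) ≠ 0 := two_ne_zero
  positivity

theorem IsSmooth.jacobian_j [NeZero (2 : F)] (h : V.IsSmooth) [V.jacobian.IsElliptic] :
    V.jacobian.j = V.jMap := by
  have := h.masterA_ne_zero
  have := h.delta_sq_add_ne_zero
  have := h.Delta_ne_zero
  have := h.mu_ne_zero
  have : (2 : F) ≠ 0 := two_ne_zero
  rw [WeierstrassCurve.j, Units.val_inv_eq_inv_val, WeierstrassCurve.coe_Δ', jacobian_discr,
    jacobian_c₄, jMap, ← masterA]
  field_simp
  ring

variable {L : Type*} [Field L] [Algebra F L]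

theorem exists_eval₂_spectralPoly_eq_zero [NeZero (2 : F)] (hΔ : V.Delta ≠ 0) {u w : L}
    (h : IsCoordinatePair F u w)
    (hw : w ^ 2 = algebraMap F L V.masterA * u ^ 4 + algebraMap F L (2 * V.tau * V.delta) * u ^ 2 +
      algebraMap F L (V.delta ^ 2 + 4 * V.Delta)) :
    ∃ l : L, IsCoordinatePair F u l ∧
      V.spectralPoly.eval₂ (aeval u : F[X] →ₐ[F] L).toRingHom l = 0 := by
  let φ := algebraMap F L
  have h2 : (2 : L) ≠ 0 := map_ofNat φ 2 ▸ (_root_.map_ne_zero φ).mpr two_ne_zero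
  have hφΔ : φ V.Delta ≠ 0 := (_root_.map_ne_zero φ).mpr hΔ
  have hu : u ≠ 0 := fun h0 => h.transcendental (h0 ▸ isAlgebraic_zero)
  obtain ⟨l, hl⟩ : ∃ l, 2 * φ V.Delta * l = u * (φ V.tau * u ^ 2 + φ V.delta + w) :=
    ⟨u * (φ V.tau * u ^ 2 + φ V.delta + w) / (2 * φ V.Delta), by field_simp⟩
  refine ⟨l, h.of_mem_adjoin h.transcendental (left_mem_adjoin_pair u l) ?_, ?_⟩
  · have hwl : w = 2 * φ V.Delta * l / u - φ V.tau * u ^ 2 - φ V.delta := by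
      rw [hl]
      field_simp
      ring
    have hφ_mem (a : F) : φ a ∈ IntermediateField.adjoin F {u, l} :=
      IntermediateField.algebraMap_mem _ a
    have hu_mem := left_mem_adjoin_pair (F := F) u l
    rw [hwl]
    exact sub_mem (sub_mem (div_mem (mul_mem (mul_mem (map_ofNat φ 2 ▸ hφ_mem 2) (hφ_mem _))
      (right_mem_adjoin_pair u l)) hu_mem) (mul_mem (hφ_mem _) (pow_mem hu_mem 2))) (hφ_mem _)
  · rw [eval₂_spectralPoly]
    simp only [masterA, map_mul, map_add, map_sub, map_pow, map_ofNat] at hw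
    apply mul_left_cancel₀ (mul_ne_zero (pow_ne_zero 2 h2) hφΔ)
    linear_combination (2 * φ V.Delta * l + u * (φ V.tau * u ^ 2 + φ V.delta + w) -
      2 * u * (φ V.tau * u ^ 2 + φ V.delta)) * hl + u ^ 2 * hw

theorem IsSmooth.spectralCurveIso [CharZero F] [IsAlgClosed F] (h : V.IsSmooth)
    {E : WeierstrassCurve F} [E.IsElliptic] (hj : V.jMap = E.j) : V.SpectralCurveIso E := by
  refine ⟨h.irreducible_spectralPoly, ?_⟩
  have := h.jacobian_isElliptic
  obtain ⟨C', hC'⟩ := WeierstrassCurve.exists_variableChange_of_j_eq E V.jacobian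
    (hj.symm.trans h.jacobian_j.symm)
  obtain ⟨x, y, hxy, heq⟩ := (isCoordinatePair_weierstrass E.toAffine).exists_of_variableChange
    (equation_weierstrass E.toAffine) C'
  obtain ⟨s, hs⟩ := IsAlgClosed.exists_pow_nat_eq V.masterA two_pos
  have hs0 : s ≠ 0 := by
    rintro rfl
    exact h.masterA_ne_zero (hs.symm.trans (zero_pow two_ne_zero))
  rw [hC', jacobian, ← hs] at heq
  obtain ⟨u, w, huw, hw⟩ := hxy.exists_biquadratic hs0 heq
  rw [← map_pow, hs] at hw
  obtain ⟨l, hul, hl⟩ := exists_eval₂_spectralPoly_eq_zero h.Delta_ne_zero huw hw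
  refine hul.nonempty_fractionRing_adjoinRoot_algEquiv h.irreducible_spectralPoly ?_ hl
  rw [spectralPoly_eq, leadingCoeff_quadratic (C_ne_zero.mpr h.Delta_ne_zero)]
  exact h.Delta_ne_zero.isUnit.map C

end SpectralCurve

end CausalPencil

section Arithmetic

section Residue

variable {K : Type*} [Field K] [NumberField K] (v : HeightOneSpectrum (𝓞 K))

theorem exists_valued_algebraMap_sub_lt_one (x : v.adicCompletion K) :
    ∃ k : K, Valued.v (algebraMap K (v.adicCompletion K) k - x) < 1 := by
  have hmem : {y : v.adicCompletion K | Valued.v (y - x) < 1} ∈ nhds x := by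
    rw [Valued.mem_nhds]
    exact ⟨1, fun y hy => by simpa [Valuation.restrict_lt_one_iff] using hy⟩
  obtain ⟨k, hk⟩ := (v.denseRange_algebraMap (K := K)).exists_mem_open isOpen_interior
    ⟨x, mem_interior_iff_mem_nhds.mpr hmem⟩
  exact ⟨k, (interior_subset hk :)⟩

variable {v} in
theorem residue_eq_zero_iff_valued_lt_one {x : v.adicCompletionIntegers K} :
    IsLocalRing.residue (v.adicCompletionIntegers K) x = 0 ↔
      Valued.v (x : v.adicCompletion K) < 1 := by
  rw [IsLocalRing.residue_eq_zero_iff, IsLocalRing.mem_maximalIdeal, mem_nonunits_iff,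
    HeightOneSpectrum.adicCompletionIntegers.isUnit_iff_valued_eq_one]
  exact (lt_iff_le_and_ne.trans (and_iff_right x.2)).symm

theorem residue_algebraMap_surjective :
    Function.Surjective ((IsLocalRing.residue (v.adicCompletionIntegers K)).comp
      (algebraMap (𝓞 K) (v.adicCompletionIntegers K))) := by
  intro z
  obtain ⟨x, rfl⟩ := IsLocalRing.residue_surjective z
  obtain ⟨k, hk⟩ := exists_valued_algebraMap_sub_lt_one v (x : v.adicCompletion K)
  have hk_int : v.valuation K k ≤ 1 := by
    rw [← HeightOneSpectrum.valuedAdicCompletion_eq_valuation' v k]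
    have := Valuation.map_add Valued.v (algebraMap K (v.adicCompletion K) k - x) x
    rw [sub_add_cancel] at this
    exact this.trans (max_le hk.le x.2)
  obtain ⟨a, ha⟩ := HeightOneSpectrum.exists_valuation_sub_lt_of_integer v hk_int 1
  have hak : Valued.v (algebraMap K (v.adicCompletion K) (algebraMap (𝓞 K) K a - k)) < 1 :=
    (HeightOneSpectrum.valuedAdicCompletion_eq_valuation' v _).trans_lt (by simpa using ha)
  refine ⟨a, ?_⟩
  rw [RingHom.comp_apply, ← sub_eq_zero, ← map_sub, residue_eq_zero_iff_valued_lt_one]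
  have hax := Valuation.map_add_lt Valued.v hak hk
  rw [map_sub, sub_add_sub_cancel] at hax
  exact hax

theorem finite_residueField_adicCompletionIntegers :
    Finite (IsLocalRing.ResidueField (v.adicCompletionIntegers K)) := by
  have : Finite (𝓞 K ⧸ v.asIdeal) := v.asIdeal.finiteQuotientOfFreeOfNeBot v.ne_bot
  refine Finite.of_surjective (Ideal.Quotient.lift v.asIdeal _ fun a ha => ?_)
    (Ideal.Quotient.lift_surjective_of_surjective _ _ (residue_algebraMap_surjective v))
  rw [RingHom.comp_apply, residue_eq_zero_iff_valued_lt_one]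
  exact (HeightOneSpectrum.valuedAdicCompletion_eq_valuation (K := K) v a).trans_lt
    ((HeightOneSpectrum.valuation_lt_one_iff_mem v a).mpr ha)

end Residue

theorem cpow_one_sub_two_mul {q : ℂ} (hq : q ≠ 0) (s : ℂ) :
    q ^ (1 - 2 * s) = q * (q ^ (-s)) ^ 2 := by
  rw [sub_eq_add_neg, Complex.cpow_add _ _ hq, Complex.cpow_one, ← Complex.cpow_nat_mul]
  congr 2
  push_cast
  ring

section EulerFactor

variable {K : Type} [Field K] [NumberField K]

theorem one_lt_primeNorm (v : HeightOneSpectrum (𝓞 K)) : 1 < primeNorm v :=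
  have := finite_residueField_adicCompletionIntegers v
  Finite.one_lt_card

theorem primeNorm_cast_ne_zero (v : HeightOneSpectrum (𝓞 K)) : (primeNorm v : ℂ) ≠ 0 := by
  exact_mod_cast (one_lt_primeNorm v).ne_bot

theorem eulerFactor_eq_of_goodPrime {W : WeierstrassCurve K} {v : HeightOneSpectrum (𝓞 K)}
    (h : GoodPrime W v) (s : ℂ) :
    eulerFactor W v s = 1 - (frobTrace W v : ℂ) * (primeNorm v : ℂ) ^ (-s) +
      (primeNorm v : ℂ) ^ (1 - 2 * s) := by
  rw [cpow_one_sub_two_mul (primeNorm_cast_ne_zero v), eulerFactor,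
    WeierstrassCurve.localPolynomial, if_pos (by exact h)]
  simp [frobTrace, primeNorm]

end EulerFactor

theorem det_one_sub_smul_inv_fin_two {F : Type*} [Field F] {A : Matrix (Fin 2) (Fin 2) F}
    (hA : IsUnit A.det) (x : F) :
    (1 - x • A⁻¹).det = 1 - x * (A.trace / A.det) + x ^ 2 / A.det := by
  have h0 : A.det ≠ 0 := hA.ne_zero
  have h : (1 - x • A⁻¹).det * A.det = (A - x • 1).det := by
    rw [← Matrix.det_mul, sub_mul, one_mul, smul_mul_assoc, Matrix.nonsing_inv_mul _ hA]
  rw [eq_div_of_mul_eq h0 h]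
  field_simp
  simp only [Matrix.det_fin_two, Matrix.trace_fin_two, Matrix.sub_apply, Matrix.smul_apply,
    Matrix.one_apply_eq, Matrix.one_apply_ne zero_ne_one, Matrix.one_apply_ne one_ne_zero,
    smul_eq_mul]
  ring

theorem exists_ne_zero_quadratic_eq_zero {F : Type*} [Field F] [IsAlgClosed F] [NeZero (2 : F)]
    {a b c : F} (ha : a ≠ 0) (hbc : b ≠ 0 ∨ c ≠ 0) : ∃ x ≠ 0, a * x ^ 2 + b * x + c = 0 := by
  obtain ⟨x, hx⟩ := exists_quadratic_eq_zero ha (IsAlgClosed.exists_eq_mul_self (discrim a b c))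
  rcases eq_or_ne x 0 with rfl | hx0
  · obtain rfl : c = 0 := by simpa using hx
    have hb : b ≠ 0 := by simpa using hbc
    refine ⟨-b / a, div_ne_zero (neg_ne_zero.mpr hb) ha, ?_⟩
    field_simp
    ring
  · exact ⟨x, hx0, by rw [sq, hx]⟩

namespace CausalPencil

section Basepoint

variable {F : Type*} [Field F] (V : CausalPencil F)

theorem pencil_eq (u l : F) :
    V.pencil u l = !![u ^ 2 - 1 - l * u⁻¹ * V.a, -(l * u⁻¹ * V.b);
      l * u⁻¹ * V.b, u ^ 2 + 1 - l * u⁻¹ * V.d] := by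
  ext i j
  fin_cases i <;> fin_cases j <;> simp [pencil, systemOp, coupling]

theorem det_pencil (u l : F) : (V.pencil u l).det =
    u ^ 4 - 1 - l * u⁻¹ * (V.tau * u ^ 2 + V.delta) + (l * u⁻¹) ^ 2 * V.Delta := by
  rw [pencil_eq, Matrix.det_fin_two_of, tau, delta, Delta]
  ring

theorem trace_pencil (u l : F) : (V.pencil u l).trace = 2 * u ^ 2 - l * u⁻¹ * V.tau := by
  rw [pencil_eq, Matrix.trace_fin_two_of, tau]
  ring

variable {V} {t q u : F}

theorem basepointLambda_mul_inv_mul_tau (hτ : V.tau ≠ 0) (hu : u ≠ 0) :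
    V.basepointLambda t q u * u⁻¹ * V.tau = 2 * u ^ 2 - t * q⁻¹ := by
  rw [basepointLambda]
  field_simp

theorem trace_pencil_basepointLambda (hτ : V.tau ≠ 0) (hu : u ≠ 0) :
    (V.pencil u (V.basepointLambda t q u)).trace = t * q⁻¹ := by
  rw [trace_pencil, basepointLambda_mul_inv_mul_tau hτ hu, sub_sub_cancel]

theorem det_pencil_basepointLambda (hτ : V.tau ≠ 0) (hu : u ≠ 0)
    (h : V.IsMasterRoot t q (u ^ 2)) : (V.pencil u (V.basepointLambda t q u)).det = q⁻¹ := by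
  have hk := basepointLambda_mul_inv_mul_tau (t := t) (q := q) hτ hu
  rw [det_pencil]
  generalize V.basepointLambda t q u * u⁻¹ = k at hk ⊢
  rw [IsMasterRoot, masterB, masterC, masterA] at h
  apply mul_left_cancel₀ (pow_ne_zero 2 hτ)
  linear_combination (V.Delta * (k * V.tau + 2 * u ^ 2 - t * q⁻¹) -
    V.tau * (V.tau * u ^ 2 + V.delta)) * hk - h

end Basepoint

theorem IsNondegenerate.producesEulerFactor {K : Type} [Field K] [NumberField K]
    {V : CausalPencil QBar} (hV : V.IsNondegenerate) {W : WeierstrassCurve K}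
    {v : HeightOneSpectrum (𝓞 K)} (hv : GoodPrime W v) : ProducesEulerFactor V W v := by
  have hVc : V.toComplex.IsNondegenerate := hV.map (algebraMap QBar ℂ)
  have hτ := hVc.tau_ne_zero
  have hA := hVc.isSmooth.masterA_ne_zero
  have hq := primeNorm_cast_ne_zero v
  refine ⟨hτ, hA, exists_ne_zero_quadratic_eq_zero hA
    (hVc.masterB_ne_zero_or_masterC_ne_zero (one_lt_primeNorm v) _), fun u hu hroot => ?_⟩
  intro A
  have hdet : A.det = (primeNorm v : ℂ)⁻¹ := det_pencil_basepointLambda hτ hu hroot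
  have htrace : A.trace = (frobTrace W v : ℂ) * (primeNorm v : ℂ)⁻¹ :=
    trace_pencil_basepointLambda hτ hu
  have hunit : IsUnit A.det := hdet ▸ (inv_ne_zero hq).isUnit
  have hresolvent (s : ℂ) : (1 - (primeNorm v : ℂ) ^ (-s) • A⁻¹).det =
      1 - (frobTrace W v : ℂ) * (primeNorm v : ℂ) ^ (-s) + (primeNorm v : ℂ) ^ (1 - 2 * s) := by
    rw [det_one_sub_smul_inv_fin_two hunit, hdet, htrace, cpow_one_sub_two_mul hq]
    field_simp
  exact ⟨hunit, fun s =>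
    ⟨hresolvent s, (hresolvent s).trans (eulerFactor_eq_of_goodPrime hv s).symm⟩⟩

end CausalPencil

end Arithmetic

section AlgebraicNumbers

open ComplexConjugate

theorem isAlgClosed_qBar : IsAlgClosed QBar :=
  (algebraicClosure.isAlgClosure ℚ ℂ).isAlgClosed

/-- The inclusion of the real algebraic numbers in `QBar`. -/
noncomputable def realAlgebraicToQBar : algebraicClosure ℚ ℝ →+* QBar :=
  (algebraMap ℝ ℂ).restrict (algebraicClosure ℚ ℝ) (algebraicClosure ℚ ℂ) fun _ hx =>
    mem_algebraicClosure_iff.mpr ((mem_algebraicClosure_iff.mp hx).algebraMap (A := ℂ))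

theorem conj_realAlgebraicToQBar (x : algebraicClosure ℚ ℝ) :
    conj (realAlgebraicToQBar x : ℂ) = realAlgebraicToQBar x :=
  Complex.conj_ofReal x

theorem mem_range_realAlgebraicToQBar {x : QBar} (hx : conj (x : ℂ) = x) :
    x ∈ realAlgebraicToQBar.range := by
  obtain ⟨r, hr⟩ := Complex.conj_eq_iff_real.mp hx
  have hr_alg : IsAlgebraic ℚ r := by
    rw [← isAlgebraic_algebraMap_iff (algebraMap ℝ ℂ).injective, Complex.coe_algebraMap, ← hr]
    exact mem_algebraicClosure_iff.mp x.2
  exact ⟨⟨r, mem_algebraicClosure_iff.mpr hr_alg⟩, Subtype.ext hr.symm⟩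

namespace CausalPencil

section SelfAdjoint

theorem fundSymm_mul_mul_fundSymm {R : Type*} [CommRing R] (a b c d : R) :
    fundSymm R * !![a, b; c, d] * fundSymm R = !![a, -b; -c, d] := by
  simp [fundSymm]

theorem isJSelfAdjoint_iff {V : CausalPencil QBar} : V.IsJSelfAdjoint ↔
    conj (V.a : ℂ) = V.a ∧ conj (V.b : ℂ) = V.b ∧ conj (V.d : ℂ) = V.d := by
  have hadj (a b c d : ℂ) : !![a, b; c, d]ᴴ = !![conj a, conj c; conj b, conj d] := by
    ext i j
    fin_cases i <;> fin_cases j <;> rfl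
  simp only [IsJSelfAdjoint, pencil_eq, hadj, fundSymm_mul_mul_fundSymm, toComplex]
  constructor
  · intro h
    have h11 := h 1 1 one_ne_zero
    exact ⟨by simpa using congrFun (congrFun h11 0) 0, by simpa using congrFun (congrFun h11 1) 0,
      by simpa using congrFun (congrFun h11 1) 1⟩
  · rintro ⟨ha, hb, hd⟩ u l -
    simp [ha, hb, hd]

theorem isJSelfAdjoint_map_realAlgebraicToQBar (V : CausalPencil (algebraicClosure ℚ ℝ)) :
    (V.map realAlgebraicToQBar).IsJSelfAdjoint :=
  isJSelfAdjoint_iff.mpr ⟨conj_realAlgebraicToQBar _, conj_realAlgebraicToQBar _,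
    conj_realAlgebraicToQBar _⟩

theorem IsJSelfAdjoint.conj_jMap {V : CausalPencil QBar} (h : V.IsJSelfAdjoint) :
    conj (V.jMap : ℂ) = V.jMap := by
  obtain ⟨ha, hb, hd⟩ := isJSelfAdjoint_iff.mp h
  have hV : V.toComplex.map (starRingEnd ℂ) = V.toComplex := by
    simp only [map, toComplex, ha, hb, hd]
  have hj : V.toComplex.jMap = V.jMap := jMap_map (algebraMap QBar ℂ) V
  rw [← hj, ← jMap_map, hV]

theorem exists_isNondegenerate_isJSelfAdjoint_jMap_eq {j : QBar} (hj : conj (j : ℂ) = j) :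
    ∃ V : CausalPencil QBar, V.IsJSelfAdjoint ∧ V.IsNondegenerate ∧ V.jMap = j := by
  have := isRealClosed_real
  have := isRealClosed_algebraicClosure ℚ ℝ
  obtain ⟨r, rfl⟩ := mem_range_realAlgebraicToQBar hj
  obtain ⟨V, hV, rfl⟩ := exists_isNondegenerate_jMap_eq_of_isRealClosed r
  exact ⟨V.map realAlgebraicToQBar, isJSelfAdjoint_map_realAlgebraicToQBar V,
    hV.map realAlgebraicToQBar, jMap_map _ V⟩

end SelfAdjoint

theorem IsNondegenerate.realises {V : CausalPencil QBar} (hV : V.IsNondegenerate)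
    {E : WeierstrassCurve QBar} [E.IsElliptic] (hj : V.jMap = E.j) : Realises V E :=
  have := isAlgClosed_qBar
  ⟨hV.isSmooth, hj, hV.isSmooth.spectralCurveIso hj,
    fun _ _ _ _ _ _ _ hv => hV.producesEulerFactor hv⟩

end CausalPencil

theorem zariskiDense_jImage_isJSelfAdjoint :
    ZariskiDense (jImage {V : CausalPencil QBar | V.IsJSelfAdjoint}) := by
  refine zariskiDense_of_infinite <| Set.infinite_of_injective_forall_mem
    (affinePoint_injective.comp Nat.cast_injective) fun n : ℕ => ?_
  obtain ⟨V, hV, hnd, hj⟩ := CausalPencil.exists_isNondegenerate_isJSelfAdjoint_jMap_eq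
    (j := n) (by simp)
  exact ⟨V, hV, hnd.isSmooth, by rw [hj, Function.comp_apply]⟩

theorem jImage_mono {F : Type*} [Field F] {S S' : Set (CausalPencil F)} (h : S ⊆ S') :
    jImage S ⊆ jImage S' :=
  fun _ ⟨V, hV, hVx⟩ => ⟨V, h hV, hVx⟩

theorem zariskiDense_jImage_univ :
    ZariskiDense (jImage (Set.univ : Set (CausalPencil QBar))) :=
  @Dense.mono _ (zariskiTopology QBar) _ _ (jImage_mono (Set.subset_univ _))
    zariskiDense_jImage_isJSelfAdjoint

theorem mainTheorem3_general :
    (ZariskiDense (jImage (Set.univ : Set (CausalPencil QBar))) ∧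
      ∀ (E : WeierstrassCurve QBar) [E.IsElliptic], ∃ V : CausalPencil QBar, Realises V E) ∧
    (ZariskiDense (jImage {V : CausalPencil QBar | V.IsJSelfAdjoint}) ∧
      ∀ (E : WeierstrassCurve QBar) [E.IsElliptic], conj (E.j : ℂ) = E.j →
        ∃ V : CausalPencil QBar, V.IsJSelfAdjoint ∧ Realises V E) := by
  have := isAlgClosed_qBar
  refine ⟨⟨zariskiDense_jImage_univ, fun E _ => ?_⟩,
    zariskiDense_jImage_isJSelfAdjoint, fun E _ hE => ?_⟩
  · obtain ⟨V, hnd, hj⟩ := CausalPencil.exists_isNondegenerate_jMap_eq E.j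
    exact ⟨V, hnd.realises hj⟩
  · obtain ⟨V, hV, hnd, hj⟩ := CausalPencil.exists_isNondegenerate_isJSelfAdjoint_jMap_eq hE
    exact ⟨V, hV, hnd.realises hj⟩

end AlgebraicNumbers

theorem mainTheorem3 :
    (ZariskiDense (jImage (Set.univ : Set (CausalPencil QBar))) ∧
      ∀ (E : WeierstrassCurve QBar) [E.IsElliptic],
        affinePoint E.j ∈ jImage (Set.univ : Set (CausalPencil QBar)) →
          ∃ V : CausalPencil QBar, Realises V E) ∧
    (ZariskiDense (jImage {V : CausalPencil QBar | V.IsJSelfAdjoint}) ∧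
      ∀ (E : WeierstrassCurve QBar) [E.IsElliptic],
        affinePoint E.j ∈ jImage {V : CausalPencil QBar | V.IsJSelfAdjoint} →
          ∃ V : CausalPencil QBar, V.IsJSelfAdjoint ∧ Realises V E) := by
  obtain ⟨⟨hdense, hreal⟩, hdense_self, hreal_self⟩ := mainTheorem3_general
  refine ⟨⟨hdense, fun E _ _ => hreal E⟩, hdense_self, fun E _ ⟨V, hV, _, hj⟩ => ?_⟩
  exact hreal_self E (affinePoint_injective hj ▸ hV.conj_jMap)
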